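/- For a locally compact abelian group $G$ and a discrete subgroup $\Lambda\subseteq G$ with annihilator $\Lambda^\perp\subseteq\widehat G$, let $E_{G,\Lambda}$ be the complex line bundle over $(G/\Lambda)\times(\widehat G/\Lambda^\perp)$ whose total space is the quotient of $G\times\widehat G\times\mathbb C$ by the relation $(x,\omega,z)\sim(x+\lambda,\,\omega\tau,\,\overline{\omega(\lambda)}\,z)$ for $\lambda\in\Lambda$, $\tau\in\Lambda^\perp$, with projection $[x,\omega,z]\mapsto([x],[\omega])$ and with the vector space structure of the fibres acting on the last coordinate. Let $p$ be a prime, let $\mathbb Z[1/p]^\Delta=\{(q,q):q\in\mathbb Z[1/p]\}\subseteq\mathbb R\times\mathbb Q_p$, and let $\mathcal S_p=(\mathbb R\times\mathbb Q_p)/\mathbb Z[1/p]^\Delta$ be the $p$-solenoid. For $x=\sum_{k\ge K}x_kp^k\in\mathbb Q_p$ with digits $x_k\in\{0,\dots,p-1\}$ write $\{x\}_p=\sum_{K\le k<0}x_kp^k$. The pairing $(s,t)\mapsto e^{2\pi i st}$ on $\mathbb R$ induces a map $$(\mathbb R/\mathbb Z)^2\to(\mathbb R/\mathbb Z)\times(\widehat{\mathbb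 R}/\mathbb Z^\perp),$$ and the pairing $((s,x),(t,y))\mapsto e^{2\pi i st}e^{-2\pi i\{xy\}_p}$ on $\mathbb R\times\mathbb Q_p$ induces a map $$\mathcal S_p^2\to\mathcal S_p\times\bigl(\widehat{\mathbb R\times\mathbb Q_p}/(\mathbb Z[1/p]^\Delta)^\perp\bigr).$$ Both maps are homeomorphisms. Regard, through them, $E=E_{\mathbb R,\mathbb Z}$ as a line bundle over $(\mathbb R/\mathbb Z)^2$ and $\tilde E=E_{\mathbb R\times\mathbb Q_p,\,\mathbb Z[1/p]^\Delta}$ as a line bundle over $\mathcal S_p^2$. Then $\tilde E$ is isomorphic, as a complex line bundle over $\mathcal S_p^2$, to the pullback of $E$ along $$\pi_0^2\colon\mathcal S_p^2\to(\mathbb R/\mathbb Z)^2,\qquad \pi_0^2([s,x],[t,y])=([s-\{x\}_p],[t-\{y\}_p]).$$ -/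

import Mathlib

open Bundle Topology
open scoped ComplexConjugate

set_option linter.unusedSectionVars false

noncomputable section

namespace GaborBundle

/-! ### The line bundle attached to a discrete subgroup of a locally compact abelian group -/

section General

variable {G : Type*} [AddCommGroup G] [TopologicalSpace G]

/-- The Pontryagin dual of an (additively written) topological abelian group. -/
abbrev CharGroup (G : Type*) [AddCommGroup G] [TopologicalSpace G] : Type _ :=
  PontryaginDual (Multiplicative G)

/-- The value of the character `ω` at `x`, as a complex number. -/
def charVal (ω : CharGroup G) (x : G) : ℂ := (ω (Multiplicative.ofAdd x) : ℂ)

/-- The annihilator of a subgroup: all characters that are trivial on it. -/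
def annihilator (Λ : AddSubgroup G) : Subgroup (CharGroup G) where
  carrier := {ω | ∀ l ∈ Λ, ω (Multiplicative.ofAdd l) = 1}
  mul_mem' {a b} ha hb l hl := by
    change a _ * b _ = 1
    rw [ha l hl, hb l hl, one_mul]
  one_mem' _ _ := rfl
  inv_mem' {a} ha l hl := by
    change (a _)⁻¹ = 1
    rw [ha l hl, inv_one]

/-- The base space `(G / Λ) × (Ĝ / Λ^⊥)`. -/
abbrev BaseSpace (Λ : AddSubgroup G) : Type _ :=
  (G ⧸ Λ) × (CharGroup G ⧸ annihilator Λ)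

theorem charVal_add (ω : CharGroup G) (x y : G) :
    charVal ω (x + y) = charVal ω x * charVal ω y := by
  simp [charVal, ofAdd_add]

theorem charVal_mul (ω τ : CharGroup G) (x : G) :
    charVal (ω * τ) x = charVal ω x * charVal τ x := rfl

theorem charVal_zero (ω : CharGroup G) : charVal ω 0 = 1 := by
  simp [charVal]

theorem charVal_mul_conj (ω : CharGroup G) (x : G) :
    charVal ω x * conj (charVal ω x) = 1 := by
  rw [Complex.mul_conj]
  simp [charVal]

theorem charVal_ne_zero (ω : CharGroup G) (x : G) : charVal ω x ≠ 0 := by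
  simp [charVal]

theorem charVal_of_mem {Λ : AddSubgroup G} {τ : CharGroup G} (hτ : τ ∈ annihilator Λ) {l : G}
    (hl : l ∈ Λ) : charVal τ l = 1 := by
  simp [charVal, hτ l hl]

theorem charVal_neg (ω : CharGroup G) (x : G) : charVal ω (-x) = conj (charVal ω x) := by
  apply mul_left_cancel₀ (charVal_ne_zero ω x)
  rw [charVal_mul_conj, ← charVal_add, add_neg_cancel, charVal_zero]

/-- The equivalence relation on `G × Ĝ × ℂ` with
`(x, ω, z) ∼ (x + l, ω τ, conj (ω l) z)` for `l ∈ Λ` and `τ ∈ Λ^⊥`. -/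
def bundleSetoid (Λ : AddSubgroup G) : Setoid (G × CharGroup G × ℂ) where
  r a b := ∃ l ∈ Λ, ∃ τ ∈ annihilator Λ,
    b.1 = a.1 + l ∧ b.2.1 = a.2.1 * τ ∧ b.2.2 = conj (charVal a.2.1 l) * a.2.2
  iseqv :=
    { refl := fun a => ⟨0, Λ.zero_mem, 1, one_mem _, by simp, by simp, by simp [charVal_zero]⟩
      symm := by
        rintro ⟨x, ω, z⟩ ⟨x', ω', z'⟩ ⟨l, hl, τ, hτ, h1, h2, h3⟩
        dsimp only at h1 h2 h3
        subst h1 h2 h3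
        refine ⟨-l, Λ.neg_mem hl, τ⁻¹, inv_mem hτ, by simp, by simp, ?_⟩
        dsimp only
        rw [charVal_neg, Complex.conj_conj, charVal_mul, charVal_of_mem hτ hl, mul_one,
          ← mul_assoc, charVal_mul_conj, one_mul]
      trans := by
        rintro ⟨x, ω, z⟩ ⟨x', ω', z'⟩ ⟨x'', ω'', z''⟩ ⟨l, hl, τ, hτ, h1, h2, h3⟩
          ⟨l', hl', τ', hτ', h1', h2', h3'⟩
        dsimp only at h1 h2 h3 h1' h2' h3'
        subst h1 h2 h3
        subst h1' h2' h3'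
        refine ⟨l + l', Λ.add_mem hl hl', τ * τ', mul_mem hτ hτ', by simp [add_assoc],
          by simp [mul_assoc], ?_⟩
        dsimp only
        rw [charVal_mul, charVal_of_mem hτ hl', mul_one, charVal_add, map_mul]
        ring }

/-- The total space of the bundle: the quotient of `G × Ĝ × ℂ` with the quotient topology. -/
def Total (Λ : AddSubgroup G) : Type _ := Quotient (bundleSetoid Λ)

instance (Λ : AddSubgroup G) : TopologicalSpace (Total Λ) :=
  inferInstanceAs (TopologicalSpace (Quotient (bundleSetoid Λ)))

/-- The class `[x, ω, z]`. -/
def Total.mk (Λ : AddSubgroup G) (x : G) (ω : CharGroup G) (z : ℂ) : Total Λ :=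
  Quotient.mk (bundleSetoid Λ) (x, ω, z)

/-- The class `([x], [ω])`. -/
abbrev baseMk (Λ : AddSubgroup G) (x : G) (ω : CharGroup G) : BaseSpace Λ :=
  ((x : G ⧸ Λ), (ω : CharGroup G ⧸ annihilator Λ))

/-- The bundle projection `[x, ω, z] ↦ ([x], [ω])`. -/
def Total.proj {Λ : AddSubgroup G} : Total Λ → BaseSpace Λ :=
  Quotient.lift (fun v => baseMk Λ v.1 v.2.1) (by
    rintro ⟨x, ω, z⟩ ⟨x', ω', z'⟩ ⟨l, hl, τ, hτ, h1, h2, -⟩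
    dsimp only at h1 h2
    subst h1 h2
    refine Prod.ext ?_ ?_
    · exact QuotientAddGroup.eq.2 (by simpa using hl)
    · exact QuotientGroup.eq.2 (by simpa using hτ))

/-- The fibre over a point of the base space. -/
def Fiber (Λ : AddSubgroup G) (b : BaseSpace Λ) : Type _ := {e : Total Λ // e.proj = b}

instance (Λ : AddSubgroup G) (b : BaseSpace Λ) : TopologicalSpace (Fiber Λ b) :=
  inferInstanceAs (TopologicalSpace {e : Total Λ // e.proj = b})

/-- The topology of the total space, transported to the disjoint union of the fibres. -/
instance (Λ : AddSubgroup G) : TopologicalSpace (TotalSpace ℂ (Fiber Λ)) :=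
  TopologicalSpace.induced (fun e => e.2.1) inferInstance

/-- The class `[x, ω, z]` as an element of the fibre over `([x], [ω])`. -/
def fiberMk (Λ : AddSubgroup G) (x : G) (ω : CharGroup G) (z : ℂ) : Fiber Λ (baseMk Λ x ω) :=
  ⟨Total.mk Λ x ω z, rfl⟩

variable {Λ : AddSubgroup G}

/-- The coordinate of `[x, ω, z]` with respect to a set-theoretic section `s` of `G → G / Λ`:
the number `w` with `[x, ω, z] = [s [x], ω, w]`. -/
def coord (s : G ⧸ Λ → G) (hs : ∀ a, (s a : G ⧸ Λ) = a) : Total Λ → ℂ :=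
  Quotient.lift (fun v => charVal v.2.1 (v.1 - s v.1) * v.2.2) (by
    rintro ⟨x, ω, z⟩ ⟨x', ω', z'⟩ ⟨l, hl, τ, hτ, h1, h2, h3⟩
    dsimp only at h1 h2 h3
    subst h1 h2 h3
    have e : ((x + l : G) : G ⧸ Λ) = (x : G ⧸ Λ) :=
      (QuotientAddGroup.eq.2 (by simpa using hl)).symm
    have m : x - s (x : G ⧸ Λ) ∈ Λ := by
      have := QuotientAddGroup.eq.1 (hs (x : G ⧸ Λ))
      rwa [neg_add_eq_sub] at this
    dsimp only
    rw [e, show x + l - s (x : G ⧸ Λ) = (x - s (x : G ⧸ Λ)) + l by abel, charVal_add,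
      charVal_mul, charVal_mul, charVal_of_mem hτ m, charVal_of_mem hτ hl]
    linear_combination (-charVal ω (x - s (x : G ⧸ Λ)) * z) * charVal_mul_conj ω l)

theorem coord_mk (s : G ⧸ Λ → G) (hs : ∀ a, (s a : G ⧸ Λ) = a) (x : G) (ω : CharGroup G) (z : ℂ) :
    coord s hs (Total.mk Λ x ω z) = charVal ω (x - s x) * z := rfl

/-- The element `[s a, ω, z]` over the point `(a, [ω])`. -/
def build (s : G ⧸ Λ → G) (b : BaseSpace Λ) (z : ℂ) : Total Λ :=
  Quotient.liftOn' b.2 (fun ω => Total.mk Λ (s b.1) ω z) (by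
    intro ω ω' h
    rw [QuotientGroup.leftRel_apply] at h
    exact Quotient.sound ⟨0, Λ.zero_mem, _, h, by simp, by simp, by simp [charVal_zero]⟩)

theorem build_mk (s : G ⧸ Λ → G) (a : G ⧸ Λ) (ω : CharGroup G) (z : ℂ) :
    build s (a, (ω : CharGroup G ⧸ annihilator Λ)) z = Total.mk Λ (s a) ω z := rfl

theorem proj_build (s : G ⧸ Λ → G) (hs : ∀ a, (s a : G ⧸ Λ) = a) (b : BaseSpace Λ) (z : ℂ) :
    (build s b z).proj = b := by
  obtain ⟨a, c⟩ := b
  induction c using QuotientGroup.induction_on with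
  | H ω => exact Prod.ext (hs a) rfl

theorem coord_build (s : G ⧸ Λ → G) (hs : ∀ a, (s a : G ⧸ Λ) = a) (b : BaseSpace Λ) (z : ℂ) :
    coord s hs (build s b z) = z := by
  obtain ⟨a, c⟩ := b
  induction c using QuotientGroup.induction_on with
  | H ω => rw [build_mk, coord_mk, hs a, sub_self, charVal_zero, one_mul]

theorem build_coord (s : G ⧸ Λ → G) (hs : ∀ a, (s a : G ⧸ Λ) = a) (e : Total Λ) :
    build s e.proj (coord s hs e) = e := by
  induction e using Quotient.inductionOn with
  | h v =>
    obtain ⟨x, ω, z⟩ := v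
    refine Quotient.sound ⟨x - s x, ?_, 1, one_mem _, ?_, by simp, ?_⟩
    · have := QuotientAddGroup.eq.1 (hs (x : G ⧸ Λ))
      rwa [neg_add_eq_sub] at this
    · exact (add_sub_cancel (s (x : G ⧸ Λ)) x).symm
    · change z = conj (charVal ω (x - s x)) * (charVal ω (x - s x) * z)
      linear_combination (-z) * charVal_mul_conj ω (x - s x)

/-- A set-theoretic section identifies each fibre with `ℂ`. -/
def fiberEquiv (s : G ⧸ Λ → G) (hs : ∀ a, (s a : G ⧸ Λ) = a) (b : BaseSpace Λ) :
    Fiber Λ b ≃ ℂ where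
  toFun e := coord s hs e.1
  invFun z := ⟨build s b z, proj_build s hs b z⟩
  left_inv := by
    rintro ⟨e, rfl⟩
    exact Subtype.ext (build_coord s hs e)
  right_inv z := coord_build s hs b z

/-- The vector space structure of the fibres, see `fiberMk_add` and `smul_fiberMk`. -/
instance (b : BaseSpace Λ) : AddCommGroup (Fiber Λ b) :=
  (fiberEquiv Quotient.out QuotientAddGroup.out_eq' b).addCommGroup

instance (b : BaseSpace Λ) : Module ℂ (Fiber Λ b) :=
  (fiberEquiv Quotient.out QuotientAddGroup.out_eq' b).module ℂ

theorem fiberMk_add (x : G) (ω : CharGroup G) (z w : ℂ) :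
    fiberMk Λ x ω z + fiberMk Λ x ω w = fiberMk Λ x ω (z + w) := by
  apply (fiberEquiv Quotient.out QuotientAddGroup.out_eq' _).injective
  rw [Equiv.add_def, Equiv.apply_symm_apply]
  exact (mul_add _ _ _).symm

theorem smul_fiberMk (x : G) (ω : CharGroup G) (μ z : ℂ) :
    μ • fiberMk Λ x ω z = fiberMk Λ x ω (μ * z) := by
  apply (fiberEquiv Quotient.out QuotientAddGroup.out_eq' _).injective
  rw [Equiv.smul_def, Equiv.apply_symm_apply]
  exact mul_left_comm _ _ _

theorem fiberMk_surjective (x : G) (ω : CharGroup G) (e : Fiber Λ (baseMk Λ x ω)) :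
    ∃ z, e = fiberMk Λ x ω z := by
  refine ⟨(fiberEquiv Quotient.out QuotientAddGroup.out_eq' _ e) *
    conj (charVal ω (x - (x : G ⧸ Λ).out)), ?_⟩
  apply (fiberEquiv Quotient.out QuotientAddGroup.out_eq' _).injective
  change _ = charVal ω (x - (x : G ⧸ Λ).out) * _
  linear_combination (-(fiberEquiv Quotient.out QuotientAddGroup.out_eq' _ e)) *
    charVal_mul_conj ω (x - (x : G ⧸ Λ).out)

theorem isLinearMap_coord (s : G ⧸ Λ → G) (hs : ∀ a, (s a : G ⧸ Λ) = a) (b : BaseSpace Λ) :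
    IsLinearMap ℂ (fun e : Fiber Λ b => coord s hs e.1) := by
  obtain ⟨a, c⟩ := b
  induction a using QuotientAddGroup.induction_on with
  | H x =>
    induction c using QuotientGroup.induction_on with
    | H ω =>
      constructor
      · intro e e'
        obtain ⟨z, rfl⟩ := fiberMk_surjective x ω e
        obtain ⟨w, rfl⟩ := fiberMk_surjective x ω e'
        have h := congrArg (fun e => coord s hs e.1) (fiberMk_add (Λ := Λ) x ω z w)
        exact h.trans (mul_add _ _ _)
      · intro μ e
        obtain ⟨z, rfl⟩ := fiberMk_surjective x ω e
        have h := congrArg (fun e => coord s hs e.1) (smul_fiberMk (Λ := Λ) x ω μ z)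
        exact h.trans (mul_left_comm _ _ _)

theorem continuous_proj : Continuous (Total.proj : Total Λ → BaseSpace Λ) := by
  refine Continuous.quotient_lift ?_ _
  exact (QuotientAddGroup.continuous_mk.comp continuous_fst).prodMk
    (QuotientGroup.continuous_mk.comp (continuous_fst.comp continuous_snd))

variable [IsTopologicalAddGroup G] [LocallyCompactSpace G]

theorem continuous_charVal : Continuous (fun v : CharGroup G × G => charVal v.1 v.2) := by
  have : LocallyCompactSpace (Multiplicative G) := inferInstanceAs (LocallyCompactSpace G)
  have h : Continuous (fun v : (Multiplicative G →ₜ* Circle) × Multiplicative G => v.1 v.2) :=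
    continuous_eval
  exact continuous_subtype_val.comp h

theorem continuousOn_coord (s : G ⧸ Λ → G) (hs : ∀ a, (s a : G ⧸ Λ) = a) {U : Set (G ⧸ Λ)}
    (hU : IsOpen U) (hc : ContinuousOn s U) :
    ContinuousOn (coord s hs) {e : Total Λ | e.proj.1 ∈ U} := by
  have ho : IsOpen {e : Total Λ | e.proj.1 ∈ U} :=
    hU.preimage (continuous_fst.comp continuous_proj)
  refine (IsQuotientMap.continuousOn_isOpen_iff
    (isQuotientMap_quot_mk : IsQuotientMap (Quotient.mk (bundleSetoid Λ))) ho).2 ?_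
  change ContinuousOn (fun v : G × CharGroup G × ℂ => charVal v.2.1 (v.1 - s v.1) * v.2.2)
    {v | (v.1 : G ⧸ Λ) ∈ U}
  refine ContinuousOn.mul ?_ (by fun_prop)
  refine continuous_charVal.comp_continuousOn (f := fun v : G × CharGroup G × ℂ =>
    (v.2.1, v.1 - s v.1)) ?_
  refine ContinuousOn.prodMk (by fun_prop) (continuousOn_fst.sub ?_)
  exact hc.comp (QuotientAddGroup.continuous_mk.comp continuous_fst).continuousOn (fun _ h => h)

theorem continuousOn_build (s : G ⧸ Λ → G) {U : Set (G ⧸ Λ)}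
    (hU : IsOpen U) (hc : ContinuousOn s U) :
    ContinuousOn (fun v : BaseSpace Λ × ℂ => build s v.1 v.2) {v | v.1.1 ∈ U} := by
  have ho : IsOpen {v : BaseSpace Λ × ℂ | v.1.1 ∈ U} :=
    hU.preimage (continuous_fst.comp continuous_fst)
  have hq : IsOpenQuotientMap (Prod.map (Prod.map id QuotientGroup.mk) id :
      ((G ⧸ Λ) × CharGroup G) × ℂ → BaseSpace Λ × ℂ) :=
    (IsOpenQuotientMap.id.prodMap QuotientGroup.isOpenQuotientMap_mk).prodMap .id
  refine (IsQuotientMap.continuousOn_isOpen_iff hq.isQuotientMap ho).2 ?_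
  change ContinuousOn (fun v : ((G ⧸ Λ) × CharGroup G) × ℂ =>
    Quotient.mk (bundleSetoid Λ) (s v.1.1, v.1.2, v.2)) {v | v.1.1 ∈ U}
  refine continuous_quotient_mk'.comp_continuousOn (f := fun v : ((G ⧸ Λ) × CharGroup G) × ℂ =>
    (s v.1.1, v.1.2, v.2)) ?_
  exact (hc.comp (f := fun v : ((G ⧸ Λ) × CharGroup G) × ℂ => v.1.1) (by fun_prop)
    (fun _ h => h)).prodMk (by fun_prop)

/-- A section of `G → G / Λ` that is continuous on an open set gives a local trivialization. -/
def triv (s : G ⧸ Λ → G) (hs : ∀ a, (s a : G ⧸ Λ) = a) (U : Set (G ⧸ Λ))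
    (hU : IsOpen U) (hc : ContinuousOn s U) : Trivialization ℂ (π ℂ (Fiber Λ)) where
  toFun e := (e.proj, coord s hs e.2.1)
  invFun v := ⟨v.1, build s v.1 v.2, proj_build s hs v.1 v.2⟩
  source := {e | e.proj.1 ∈ U}
  target := {v | v.1.1 ∈ U}
  map_source' _ h := h
  map_target' _ h := h
  left_inv' := by
    rintro ⟨b, e, rfl⟩ -
    exact congrArg (TotalSpace.mk (F := ℂ) e.proj) (Subtype.ext (build_coord s hs e))
  right_inv' := by
    rintro ⟨b, z⟩ -
    exact Prod.ext rfl (coord_build s hs b z)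
  open_source := by
    have h : Continuous (fun e : TotalSpace ℂ (Fiber Λ) => e.2.1) := continuous_induced_dom
    have e : {e : TotalSpace ℂ (Fiber Λ) | e.proj.1 ∈ U} =
        (fun e : TotalSpace ℂ (Fiber Λ) => (Total.proj e.2.1).1) ⁻¹' U := by
      ext e
      rw [Set.mem_preimage, e.2.2]
      rfl
    rw [e]
    exact hU.preimage (continuous_fst.comp (continuous_proj.comp h))
  open_target := hU.preimage (continuous_fst.comp continuous_fst)
  continuousOn_toFun := by
    have h : Continuous (fun e : TotalSpace ℂ (Fiber Λ) => e.2.1) := continuous_induced_dom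
    refine ContinuousOn.prodMk ?_ ?_
    · have : (fun e : TotalSpace ℂ (Fiber Λ) => e.proj) = fun e => Total.proj e.2.1 := by
        ext1 e
        exact e.2.2.symm
      exact (this ▸ continuous_proj.comp h :
        Continuous (fun e : TotalSpace ℂ (Fiber Λ) => e.proj)).continuousOn
    · refine (continuousOn_coord s hs hU hc).comp h.continuousOn ?_
      intro e he
      change (Total.proj e.2.1).1 ∈ U
      rw [e.2.2]
      exact he
  continuousOn_invFun :=
    (IsInducing.continuousOn_iff ⟨rfl⟩).2 (continuousOn_build s hU hc)
  baseSet := U ×ˢ Set.univ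
  open_baseSet := hU.prod isOpen_univ
  source_eq := by ext; simp
  target_eq := by ext; simp
  proj_toFun _ _ := rfl

variable [hΛ : DiscreteTopology Λ]

theorem exists_section (a : G ⧸ Λ) : ∃ (s : G ⧸ Λ → G) (_ : ∀ a, (s a : G ⧸ Λ) = a)
    (U : Set (G ⧸ Λ)) (_ : IsOpen U) (_ : ContinuousOn s U), a ∈ U := by
  classical
  have hcov := (Λ.isAddQuotientCoveringMap ⟨hΛ⟩).isCoveringMap
  obtain ⟨x, rfl⟩ := QuotientAddGroup.mk_surjective a
  obtain ⟨e, hx, he⟩ := hcov.isLocalHomeomorph x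
  refine ⟨fun a => if a ∈ e.target then e.symm a else a.out, ?_, e.target, e.open_target, ?_, ?_⟩
  · intro a
    dsimp only
    split_ifs with h
    · exact (congrFun he _).trans (e.right_inv h)
    · exact QuotientAddGroup.out_eq' a
  · exact e.continuousOn_symm.congr (fun a h => if_pos h)
  · rw [he]
    exact e.map_source hx

/-- The bundle is locally trivial. -/
instance : FiberBundle ℂ (Fiber Λ) where
  totalSpaceMk_isInducing' b := by
    have h : IsInducing (fun e : TotalSpace ℂ (Fiber Λ) => e.2.1) := ⟨rfl⟩
    exact (h.of_comp_iff (f := TotalSpace.mk b)).1 IsInducing.subtypeVal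
  trivializationAtlas' := {e | ∃ s hs U hU hc, e = triv s hs U hU hc}
  trivializationAt' b :=
    triv (exists_section b.1).choose (exists_section b.1).choose_spec.choose
      (exists_section b.1).choose_spec.choose_spec.choose
      (exists_section b.1).choose_spec.choose_spec.choose_spec.choose
      (exists_section b.1).choose_spec.choose_spec.choose_spec.choose_spec.choose
  mem_baseSet_trivializationAt' b :=
    ⟨(exists_section b.1).choose_spec.choose_spec.choose_spec.choose_spec.choose_spec, trivial⟩
  trivialization_mem_atlas' b := ⟨_, _, _, _, _, rfl⟩

/-- The bundle is a complex vector bundle of rank one. -/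
instance : VectorBundle ℂ ℂ (Fiber Λ) where
  trivialization_linear' := by
    rintro e ⟨s, hs, U, hU, hc, rfl⟩
    exact ⟨fun b _ => isLinearMap_coord s hs b⟩
  continuousOn_coordChange' := by
    rintro e e' ⟨he⟩ ⟨he'⟩
    have hl : e.IsLinear ℂ := by
      obtain ⟨s, hs, U, hU, hc, rfl⟩ := he
      exact ⟨fun b _ => isLinearMap_coord s hs b⟩
    have hl' : e'.IsLinear ℂ := by
      obtain ⟨s, hs, U, hU, hc, rfl⟩ := he'
      exact ⟨fun b _ => isLinearMap_coord s hs b⟩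
    refine continuousOn_clm_apply.2 fun z => ?_
    have h : ContinuousOn (fun b => (e' (e.toOpenPartialHomeomorph.symm (b, z))).2)
        (e.baseSet ∩ e'.baseSet) := by
      refine continuous_snd.comp_continuousOn (e'.continuousOn.comp
        (e.toOpenPartialHomeomorph.continuousOn_symm.comp (by fun_prop) ?_) ?_)
      · intro b hb
        exact e.mem_target.2 hb.1
      · intro b hb
        rw [e'.mem_source, e.proj_symm_apply' hb.1]
        exact hb.2
    exact h.congr fun b hb => Trivialization.coordChangeL_apply' e e' hb z

end General

/-! ### Isomorphisms of vector bundles -/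

/-- An isomorphism of vector bundles over the same base: a family of linear isomorphisms of the
fibres that is, together with its inverse, continuous on total spaces. -/
structure VectorBundleIso (𝕜 : Type*) {B : Type*} (F F' : Type*) (E E' : B → Type*)
    [NontriviallyNormedField 𝕜] [TopologicalSpace B]
    [NormedAddCommGroup F] [NormedSpace 𝕜 F] [NormedAddCommGroup F'] [NormedSpace 𝕜 F']
    [∀ b, AddCommMonoid (E b)] [∀ b, Module 𝕜 (E b)] [∀ b, TopologicalSpace (E b)]
    [TopologicalSpace (TotalSpace F E)] [FiberBundle F E] [VectorBundle 𝕜 F E]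
    [∀ b, AddCommMonoid (E' b)] [∀ b, Module 𝕜 (E' b)] [∀ b, TopologicalSpace (E' b)]
    [TopologicalSpace (TotalSpace F' E')] [FiberBundle F' E'] [VectorBundle 𝕜 F' E'] where
  /-- The isomorphism of the fibres over a point. -/
  fiberEquiv : ∀ b, E b ≃ₗ[𝕜] E' b
  continuous_toFun : Continuous
    (fun e : TotalSpace F E => (⟨e.1, fiberEquiv e.1 e.2⟩ : TotalSpace F' E'))
  continuous_invFun : Continuous
    (fun e : TotalSpace F' E' => (⟨e.1, (fiberEquiv e.1).symm e.2⟩ : TotalSpace F E))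

/-! ### Pairings of a group with itself -/

section Pairing

variable {G : Type*} [AddCommGroup G] [TopologicalSpace G]

/-- The homomorphism `w ↦ β(·, w)` from `G` to its dual given by a continuous bicharacter `β`. -/
def pairingHom (β : G → G → Circle) (h1 : ∀ x y w, β (x + y) w = β x w * β y w)
    (h2 : ∀ x v w, β x (v + w) = β x v * β x w) (hc : Continuous (fun v : G × G => β v.1 v.2)) :
    Multiplicative G →ₜ* CharGroup G where
  toFun w :=
    (ContinuousMonoidHom.mk
      (MonoidHom.mk' (fun x : Multiplicative G => β x.toAdd w.toAdd) fun x y => h1 _ _ _)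
      (hc.comp ((continuous_id : Continuous (id : G → G)).prodMk
        (continuous_const (y := w.toAdd)))) : Multiplicative G →ₜ* Circle)
  map_one' := PontryaginDual.ext fun x => by
    have h := h2 x.toAdd 0 0
    rw [add_zero] at h
    exact left_eq_mul.1 h
  map_mul' v w := PontryaginDual.ext fun x => h2 _ _ _
  continuous_toFun := ContinuousMonoidHom.continuous_of_continuous_uncurry _
    (hc.comp (continuous_swap : Continuous (Prod.swap : G × G → G × G)))

/-- The map `(G / Λ) × (G / Λ) → (G / Λ) × (Ĝ / Λ^⊥)`, `([x], [w]) ↦ ([x], [χ w])`, for a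
homomorphism `χ : G → Ĝ` that maps `Λ` into `Λ^⊥`. -/
def baseMap (Λ : AddSubgroup G) [IsTopologicalAddGroup G] (χ : Multiplicative G →ₜ* CharGroup G)
    (h : ∀ l ∈ Λ, χ (Multiplicative.ofAdd l) ∈ annihilator Λ) :
    C((G ⧸ Λ) × (G ⧸ Λ), BaseSpace Λ) where
  toFun := Prod.map id (Quotient.map' (fun w : G => χ (Multiplicative.ofAdd w)) (by
    intro v w hvw
    rw [QuotientAddGroup.leftRel_apply] at hvw
    rw [QuotientGroup.leftRel_apply, ← map_inv, ← map_mul]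
    exact h _ hvw))
  continuous_toFun := continuous_id.prodMap
    ((map_continuous χ : Continuous χ).quotient_map' _)

end Pairing

/-! ### The case of `ℤ` in `ℝ` -/

/-- The subgroup `ℤ` of `ℝ`. The quotient `ℝ / ℤ` is Mathlib's `UnitAddCircle`. -/
abbrev intLattice : AddSubgroup ℝ := AddSubgroup.zmultiples (1 : ℝ)

/-- The pairing `(s, t) ↦ e^{2πi s t}` of `ℝ` with itself. -/
def realPairing : Multiplicative ℝ →ₜ* CharGroup ℝ :=
  pairingHom (fun s t => Real.fourierChar (s * t))
    (fun x y w => by rw [add_mul, AddChar.map_add_eq_mul])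
    (fun x v w => by rw [mul_add, AddChar.map_add_eq_mul])
    (by fun_prop)

theorem fourierChar_intCast (n : ℤ) : Real.fourierChar (n : ℝ) = 1 := by
  ext
  rw [Real.fourierChar_apply, Circle.coe_one, Complex.exp_eq_one_iff]
  exact ⟨n, by push_cast; ring⟩

theorem realPairing_mem : ∀ l ∈ intLattice,
    realPairing (Multiplicative.ofAdd l) ∈ annihilator intLattice := by
  rintro _ ⟨m, rfl⟩ _ ⟨n, rfl⟩
  change Real.fourierChar (n • (1 : ℝ) * m • (1 : ℝ)) = 1
  rw [← fourierChar_intCast (n * m)]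
  simp

/-- The identification of `(ℝ / ℤ)²` with `(ℝ / ℤ) × (ℝ̂ / ℤ^⊥)`. -/
def torusBase : C(UnitAddCircle × UnitAddCircle, BaseSpace intLattice) :=
  baseMap intLattice realPairing realPairing_mem

/-- The line bundle of the pair `(ℝ, ℤ)`, over `(ℝ / ℤ)²`. -/
abbrev torusBundle : UnitAddCircle × UnitAddCircle → Type :=
  torusBase *ᵖ (Fiber intLattice)

/-! ### The case of `ℤ[1/p]` in `ℝ × ℚ_p` -/

section Solenoid

variable (p : ℕ) [hp : Fact p.Prime]

/-- The subgroup `ℤ[1/p]` of `ℚ`. -/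
def zInv : AddSubgroup ℚ where
  carrier := {q | ∃ (n : ℤ) (k : ℕ), q = n / (p : ℚ) ^ k}
  zero_mem' := ⟨0, 0, by simp⟩
  add_mem' := by
    rintro _ _ ⟨n, k, rfl⟩ ⟨m, l, rfl⟩
    have : (p : ℚ) ≠ 0 := by exact_mod_cast hp.1.ne_zero
    refine ⟨n * p ^ l + m * p ^ k, k + l, ?_⟩
    push_cast
    field_simp
    ring
  neg_mem' := by
    rintro _ ⟨n, k, rfl⟩
    exact ⟨-n, k, by push_cast; ring⟩

/-- The diagonal copy `{(q, q) : q ∈ ℤ[1/p]}` of `ℤ[1/p]` in `ℝ × ℚ_p`. -/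
def diagLattice : AddSubgroup (ℝ × ℚ_[p]) :=
  (zInv p).map ((Rat.castHom ℝ).toAddMonoidHom.prod (Rat.castHom ℚ_[p]).toAddMonoidHom)

/-- The `p`-solenoid, realized as the quotient `(ℝ × ℚ_p) / ℤ[1/p]^Δ`. -/
abbrev Solenoid : Type := (ℝ × ℚ_[p]) ⧸ diagLattice p

variable {p}

theorem mem_diagLattice {v : ℝ × ℚ_[p]} :
    v ∈ diagLattice p ↔ ∃ q ∈ zInv p, v = ((q : ℝ), (q : ℚ_[p])) :=
  ⟨fun ⟨q, hq, h⟩ => ⟨q, hq, h.symm⟩, fun ⟨q, hq, h⟩ => ⟨q, hq, h.symm⟩⟩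

theorem zInv_mul {q r : ℚ} (hq : q ∈ zInv p) (hr : r ∈ zInv p) : q * r ∈ zInv p := by
  obtain ⟨n, k, rfl⟩ := hq
  obtain ⟨m, l, rfl⟩ := hr
  exact ⟨n * m, k + l, by push_cast; rw [div_mul_div_comm, pow_add]⟩

/-- An element of `ℤ[1/p]` that is a `p`-adic integer is an integer. -/
theorem exists_int_of_norm_le_one {q : ℚ} (hq : q ∈ zInv p) (h : ‖(q : ℚ_[p])‖ ≤ 1) :
    ∃ m : ℤ, q = m := by
  obtain ⟨n, k, rfl⟩ := hq
  have hp0 : (p : ℚ) ≠ 0 := by exact_mod_cast hp.1.ne_zero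
  have hpos : (0 : ℝ) < p := by exact_mod_cast hp.1.pos
  push_cast at h
  rw [norm_div, norm_pow, Padic.norm_p, div_le_one (by positivity), inv_pow,
    ← zpow_natCast, ← zpow_neg, Padic.norm_int_le_pow_iff_dvd] at h
  obtain ⟨m, rfl⟩ := h
  refine ⟨m, ?_⟩
  push_cast
  field_simp

variable (p) in
/-- For every `x ∈ ℚ_p`, `p ^ n x` is a `p`-adic integer when `n` is the number of digits of `x`
after the `p`-adic point. -/
theorem norm_pow_mul_le_one (x : ℚ_[p]) : ‖(p : ℚ_[p]) ^ (-x.valuation).toNat * x‖ ≤ 1 := by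
  by_cases hx : x = 0
  · simp [hx]
  have hp1 : (1 : ℝ) ≤ p := by exact_mod_cast hp.1.one_le
  have hpos : (0 : ℝ) < p := by linarith
  rw [norm_mul, norm_pow, Padic.norm_p, Padic.norm_eq_zpow_neg_valuation hx, inv_pow,
    ← zpow_natCast, ← zpow_neg, ← zpow_add₀ hpos.ne']
  apply zpow_le_one_of_nonpos₀ hp1
  have := Int.self_le_toNat (-x.valuation)
  linarith

/-- The number of digits of `x` after the `p`-adic point. -/
def padicDigits (x : ℚ_[p]) : ℕ := (-x.valuation).toNat

/-- The `p`-adic integer `p ^ n x`, where `n` is the number of digits of `x` after the `p`-adic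
point. -/
def padicShift (x : ℚ_[p]) : ℤ_[p] := ⟨(p : ℚ_[p]) ^ padicDigits x * x, norm_pow_mul_le_one p x⟩

/-- The fractional part `{x}_p = ∑_{k < 0} x_k p ^ k` of `x = ∑_k x_k p ^ k`, with digits
`x_k ∈ {0, …, p - 1}`: with `n` digits after the `p`-adic point, `p ^ n {x}_p` is the truncation of
the `p`-adic integer `p ^ n x` to its first `n` digits. -/
def padicFrac (x : ℚ_[p]) : ℚ :=
  ((padicShift x).appr (padicDigits x) : ℚ) / (p : ℚ) ^ padicDigits x

theorem padicFrac_mem (x : ℚ_[p]) : padicFrac x ∈ zInv p :=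
  ⟨_, _, by rw [padicFrac, Int.cast_natCast]⟩

theorem padicFrac_nonneg (x : ℚ_[p]) : 0 ≤ padicFrac x := by
  unfold padicFrac
  positivity

theorem padicFrac_lt_one (x : ℚ_[p]) : padicFrac x < 1 := by
  have hpos : (0 : ℚ) < p := by exact_mod_cast hp.1.pos
  rw [padicFrac, div_lt_one (by positivity)]
  exact_mod_cast PadicInt.appr_lt _ _

theorem norm_sub_padicFrac_le (x : ℚ_[p]) : ‖x - (padicFrac x : ℚ_[p])‖ ≤ 1 := by
  have hp0 : (p : ℚ_[p]) ≠ 0 := by exact_mod_cast hp.1.ne_zero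
  obtain ⟨c, hc⟩ := Ideal.mem_span_singleton.1
    (PadicInt.appr_spec (padicDigits x) (padicShift x))
  have hc' : (p : ℚ_[p]) ^ padicDigits x * x - ((padicShift x).appr (padicDigits x) : ℚ_[p]) =
      (p : ℚ_[p]) ^ padicDigits x * (c : ℚ_[p]) := by
    have := congrArg PadicInt.Coe.ringHom hc
    rw [map_sub, map_mul, map_pow, map_natCast, map_natCast] at this
    exact this
  have : x - (padicFrac x : ℚ_[p]) = c := by
    rw [padicFrac]
    push_cast
    have h0 := pow_ne_zero (padicDigits x) hp0
    rw [sub_eq_iff_eq_add, ← mul_right_inj' h0, mul_add, mul_div_cancel₀ _ h0]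
    linear_combination hc'
  rw [this]
  exact c.norm_le_one

theorem norm_sub_le_one {x y : ℚ_[p]} (hx : ‖x‖ ≤ 1) (hy : ‖y‖ ≤ 1) : ‖x - y‖ ≤ 1 := by
  rw [sub_eq_add_neg]
  exact (IsUltrametricDist.norm_add_le_max _ _).trans (max_le hx (by rwa [norm_neg]))

/-- The fractional part is the only element of `ℤ[1/p] ∩ [0, 1)` that differs from `x` by a
`p`-adic integer. -/
theorem padicFrac_unique {x : ℚ_[p]} {q : ℚ} (hq : q ∈ zInv p) (h0 : 0 ≤ q) (h1 : q < 1)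
    (h : ‖x - (q : ℚ_[p])‖ ≤ 1) : padicFrac x = q := by
  have hn : ‖((padicFrac x - q : ℚ) : ℚ_[p])‖ ≤ 1 := by
    have e : ((padicFrac x - q : ℚ) : ℚ_[p]) =
        (x - (q : ℚ_[p])) - (x - (padicFrac x : ℚ_[p])) := by
      push_cast
      ring
    rw [e]
    exact norm_sub_le_one h (norm_sub_padicFrac_le x)
  obtain ⟨m, hm⟩ := exists_int_of_norm_le_one ((zInv p).sub_mem (padicFrac_mem x) hq) hn
  have a0 := padicFrac_nonneg x
  have a1 := padicFrac_lt_one x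
  have b0 : (-1 : ℚ) < m := by linarith
  have b1 : (m : ℚ) < 1 := by linarith
  have : m = 0 := by
    have b0' : (-1 : ℤ) < m := by exact_mod_cast b0
    have b1' : m < (1 : ℤ) := by exact_mod_cast b1
    omega
  rw [this, Int.cast_zero] at hm
  linarith

theorem padicFrac_congr {x y : ℚ_[p]} (h : ‖x - y‖ ≤ 1) : padicFrac x = padicFrac y := by
  refine padicFrac_unique (padicFrac_mem y) (padicFrac_nonneg y) (padicFrac_lt_one y) ?_
  rw [show x - (padicFrac y : ℚ_[p]) = (x - y) + (y - (padicFrac y : ℚ_[p])) by ring]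
  exact (IsUltrametricDist.norm_add_le_max _ _).trans (max_le h (norm_sub_padicFrac_le y))

theorem padicFrac_add (x y : ℚ_[p]) :
    ∃ m : ℤ, padicFrac (x + y) = padicFrac x + padicFrac y + m := by
  have hn : ‖((padicFrac (x + y) - (padicFrac x + padicFrac y) : ℚ) : ℚ_[p])‖ ≤ 1 := by
    have e : ((padicFrac (x + y) - (padicFrac x + padicFrac y) : ℚ) : ℚ_[p]) =
        ((x - (padicFrac x : ℚ_[p])) + (y - (padicFrac y : ℚ_[p]))) -
          (x + y - (padicFrac (x + y) : ℚ_[p])) := by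
      push_cast
      ring
    rw [e]
    exact norm_sub_le_one
      ((IsUltrametricDist.norm_add_le_max _ _).trans
        (max_le (norm_sub_padicFrac_le x) (norm_sub_padicFrac_le y)))
      (norm_sub_padicFrac_le (x + y))
  obtain ⟨m, hm⟩ := exists_int_of_norm_le_one ((zInv p).sub_mem (padicFrac_mem _)
    ((zInv p).add_mem (padicFrac_mem x) (padicFrac_mem y))) hn
  exact ⟨m, by linarith⟩

theorem padicFrac_of_mem {q : ℚ} (hq : q ∈ zInv p) :
    ∃ m : ℤ, padicFrac (q : ℚ_[p]) = q + m := by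
  have hn : ‖((padicFrac (q : ℚ_[p]) - q : ℚ) : ℚ_[p])‖ ≤ 1 := by
    push_cast
    rw [norm_sub_rev]
    exact norm_sub_padicFrac_le _
  obtain ⟨m, hm⟩ := exists_int_of_norm_le_one ((zInv p).sub_mem (padicFrac_mem _) hq) hn
  exact ⟨m, by linarith⟩

theorem continuous_padicFrac : Continuous (fun x : ℚ_[p] => (padicFrac x : ℝ)) := by
  refine IsLocallyConstant.continuous ((IsLocallyConstant.iff_eventually_eq _).2 fun x => ?_)
  filter_upwards [Metric.ball_mem_nhds x one_pos] with y hy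
  rw [padicFrac_congr (x := y) (y := x) (by rw [← dist_eq_norm]; exact hy.le)]

instance : DiscreteTopology (diagLattice p) := by
  refine discreteTopology_of_isOpen_singleton_zero ?_
  rw [isOpen_induced_iff]
  refine ⟨Metric.ball 0 1, Metric.isOpen_ball, ?_⟩
  ext ⟨v, hv⟩
  simp only [Set.mem_preimage, Metric.mem_ball, dist_zero_right, Set.mem_singleton_iff]
  refine ⟨fun h => ?_, fun h => ?_⟩
  swap
  · obtain rfl : v = 0 := congrArg Subtype.val h
    simp
  obtain ⟨q, hq, rfl⟩ := mem_diagLattice.1 hv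
  rw [Prod.norm_def, max_lt_iff] at h
  obtain ⟨m, rfl⟩ := exists_int_of_norm_le_one hq h.2.le
  have h1 := h.1
  simp only [Rat.cast_intCast, Real.norm_eq_abs] at h1
  have : m = 0 := by
    rw [← Int.cast_abs] at h1
    exact Int.abs_lt_one_iff.1 (by exact_mod_cast h1)
  subst this
  ext <;> simp

variable (p) in
/-- The pairing `((s, x), (t, y)) ↦ e^{2πi s t} e^{-2πi {x y}_p}` of `ℝ × ℚ_p` with itself. -/
def rqPairing : Multiplicative (ℝ × ℚ_[p]) →ₜ* CharGroup (ℝ × ℚ_[p]) :=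
  pairingHom
    (fun v w => Real.fourierChar (v.1 * w.1) * Real.fourierChar (-(padicFrac (v.2 * w.2) : ℝ)))
    (fun x y w => by
      obtain ⟨m, hm⟩ := padicFrac_add (x.2 * w.2) (y.2 * w.2)
      have e : -((padicFrac (x.2 * w.2 + y.2 * w.2) : ℚ) : ℝ) =
          -(padicFrac (x.2 * w.2) : ℝ) + -(padicFrac (y.2 * w.2) : ℝ) + ((-m : ℤ) : ℝ) := by
        rw [hm]
        push_cast
        ring
      rw [Prod.fst_add, Prod.snd_add, add_mul, add_mul, e]
      simp only [AddChar.map_add_eq_mul, fourierChar_intCast, mul_one]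
      exact mul_mul_mul_comm _ _ _ _)
    (fun x v w => by
      obtain ⟨m, hm⟩ := padicFrac_add (x.2 * v.2) (x.2 * w.2)
      have e : -((padicFrac (x.2 * v.2 + x.2 * w.2) : ℚ) : ℝ) =
          -(padicFrac (x.2 * v.2) : ℝ) + -(padicFrac (x.2 * w.2) : ℝ) + ((-m : ℤ) : ℝ) := by
        rw [hm]
        push_cast
        ring
      rw [Prod.fst_add, Prod.snd_add, mul_add, mul_add, e]
      simp only [AddChar.map_add_eq_mul, fourierChar_intCast, mul_one]
      exact mul_mul_mul_comm _ _ _ _)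
    (by
      have h : Continuous (fun v : (ℝ × ℚ_[p]) × (ℝ × ℚ_[p]) =>
          (padicFrac (v.1.2 * v.2.2) : ℝ)) :=
        continuous_padicFrac.comp (by fun_prop)
      fun_prop)

theorem rqPairing_mem : ∀ l ∈ diagLattice p,
    rqPairing p (Multiplicative.ofAdd l) ∈ annihilator (diagLattice p) := by
  intro l hl v hv
  obtain ⟨q, hq, rfl⟩ := mem_diagLattice.1 hl
  obtain ⟨r, hr, rfl⟩ := mem_diagLattice.1 hv
  change Real.fourierChar ((r : ℝ) * (q : ℝ)) *
    Real.fourierChar (-(padicFrac ((r : ℚ_[p]) * (q : ℚ_[p])) : ℝ)) = 1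
  obtain ⟨m, hm⟩ := padicFrac_of_mem (zInv_mul hr hq)
  rw [← Rat.cast_mul (α := ℚ_[p]), hm, ← AddChar.map_add_eq_mul, ← fourierChar_intCast (-m)]
  congr 1
  push_cast
  ring

variable (p)

/-- The identification of the squared solenoid with the base space of the bundle of the pair
`(ℝ × ℚ_p, ℤ[1/p]^Δ)`. -/
def solenoidBase : C(Solenoid p × Solenoid p, BaseSpace (diagLattice p)) :=
  baseMap (diagLattice p) (rqPairing p) rqPairing_mem

/-- The line bundle of the pair `(ℝ × ℚ_p, ℤ[1/p]^Δ)`, over the squared solenoid. -/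
abbrev solenoidBundle : Solenoid p × Solenoid p → Type :=
  solenoidBase p *ᵖ (Fiber (diagLattice p))

/-- The projection `[s, x] ↦ [s - {x}_p]` of the solenoid onto `ℝ / ℤ`. -/
def solenoidProj : C(Solenoid p, UnitAddCircle) where
  toFun := Quotient.lift (fun v : ℝ × ℚ_[p] => ((v.1 - padicFrac v.2 : ℝ) : UnitAddCircle)) (by
    intro v w h
    obtain ⟨q, hq, h⟩ := mem_diagLattice.1 (QuotientAddGroup.leftRel_apply.1 h)
    obtain rfl : w = v + ((q : ℝ), (q : ℚ_[p])) := by rw [← h]; abel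
    obtain ⟨m, hm⟩ := padicFrac_of_mem hq
    obtain ⟨n, hn⟩ := padicFrac_add v.2 (q : ℚ_[p])
    refine QuotientAddGroup.eq.2 (AddSubgroup.mem_zmultiples_iff.2 ⟨-(m + n), ?_⟩)
    rw [Prod.fst_add, Prod.snd_add, hn, hm]
    simp only [zsmul_eq_mul]
    push_cast
    ring)
  continuous_toFun := Continuous.quotient_lift ((AddCircle.continuous_mk' 1).comp
    (continuous_fst.sub (continuous_padicFrac.comp continuous_snd))) _

/-- The projection `([s, x], [t, y]) ↦ ([s - {x}_p], [t - {y}_p])` of the squared solenoid onto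
`(ℝ / ℤ)²`. -/
def solenoidProjSq : C(Solenoid p × Solenoid p, UnitAddCircle × UnitAddCircle) :=
  (solenoidProj p).prodMap (solenoidProj p)

end Solenoid

end GaborBundle

end

noncomputable section

namespace GaborBundle

/-! ### Criterion for the identification of the base spaces -/

section General

variable {G : Type*} [AddCommGroup G] [TopologicalSpace G]

/-! Subtracting the diagonal element `{x}_p` brings every point of the solenoid into `ℝ × ℤ_p`, and
the lattice elements lying in `ℝ × ℤ_p` are exactly the integers `(n, n)`. Such an element pairs
with `(t, y)`, `y ∈ ℤ_p`, to `e^{2πi n t}`, because `{n y}_p = 0`. Hence, on representatives with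
`x, y ∈ ℤ_p`, both bundles glue by the same factors, and `[(s, x), (t, y), z] ↦ [s, t, z]` is the
isomorphism of the fibres.

For continuity, a section `s` of `ℝ → ℝ / ℤ` is lifted to a section of `ℝ × ℚ_p → 𝒮_p` with first
coordinate `s ∘ π₀`, continuous over `π₀⁻¹ U` when `s` is continuous on `U`
(`continuousOn_liftSection`). In the coordinates given by the lift and by `s` the isomorphism is the
identity of `ℂ` (`coord_liftSection_mk`), so it does not depend on `s` (`solenoidFiberEquiv_eq`) and
can be checked locally.

The maps of base spaces are continuous bijections from compact to Hausdorff spaces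
(`isHomeomorph_baseMap`). For the solenoid, injectivity comes from testing against `(1, 1)` and all
`(p⁻ᵏ, p⁻ᵏ)`; surjectivity is a compactness argument, as a character of `ℤ[1/p]` is determined by
its values at the `p⁻ᵏ`. -/

theorem isClosed_annihilator (Λ : AddSubgroup G) :
    IsClosed (annihilator Λ : Set (CharGroup G)) := by
  have h : (annihilator Λ : Set (CharGroup G)) =
      ⋂ l ∈ Λ, {ω : CharGroup G | ω (Multiplicative.ofAdd l) = 1} := by
    ext ω
    simp only [Set.mem_iInter]
    rfl
  rw [h]
  refine isClosed_biInter fun l _ => isClosed_eq ?_ continuous_const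
  exact (continuous_eval_const (F := Multiplicative G →ₜ* Circle) (Multiplicative.ofAdd l))

/-- If `χ : G → Ĝ` is such that `χ w` is trivial on `Λ` only for `w ∈ Λ`, and every character
agrees on `Λ` with some `χ w`, then it identifies `(G / Λ)²` with `(G / Λ) × (Ĝ / Λ^⊥)`. -/
theorem isHomeomorph_baseMap [IsTopologicalAddGroup G] [T2Space G] (Λ : AddSubgroup G)
    [DiscreteTopology Λ] [CompactSpace (G ⧸ Λ)] (χ : Multiplicative G →ₜ* CharGroup G)
    (h : ∀ l ∈ Λ, χ (Multiplicative.ofAdd l) ∈ annihilator Λ)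
    (hinj : ∀ w, χ (Multiplicative.ofAdd w) ∈ annihilator Λ → w ∈ Λ)
    (hsurj : ∀ ω : CharGroup G, ∃ w, ∀ l ∈ Λ,
      χ (Multiplicative.ofAdd w) (Multiplicative.ofAdd l) = ω (Multiplicative.ofAdd l)) :
    IsHomeomorph (baseMap Λ χ h) := by
  -- Quotients by closed subgroups are Hausdorff, so it remains to prove bijectivity.
  have : IsClosed (Λ : Set G) := AddSubgroup.isClosed_of_discrete
  have := isClosed_annihilator Λ
  refine isHomeomorph_iff_continuous_bijective.2 ⟨map_continuous _, ?_, ?_⟩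
  · refine Function.injective_id.prodMap fun a b hab => ?_
    induction a using QuotientAddGroup.induction_on with
    | H v =>
      induction b using QuotientAddGroup.induction_on with
      | H w =>
        refine QuotientAddGroup.eq.2 (hinj _ ?_)
        have := QuotientGroup.eq.1 hab
        rwa [← map_inv, ← map_mul] at this
  · refine Function.surjective_id.prodMap fun c => ?_
    induction c using QuotientGroup.induction_on with
    | H ω =>
      obtain ⟨w, hw⟩ := hsurj ω
      refine ⟨(w : G ⧸ Λ), QuotientGroup.eq.2 fun l hl => ?_⟩
      change (χ (Multiplicative.ofAdd w) (Multiplicative.ofAdd l))⁻¹ * ω _ = 1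
      rw [hw l hl, inv_mul_cancel]

end General

/-! ### The torus -/

theorem fourierChar_surjective : Function.Surjective Real.fourierChar := by
  intro z
  refine ⟨Complex.arg z / (2 * Real.pi), ?_⟩
  rw [Real.fourierChar_apply', mul_div_cancel₀ _ (by positivity), Circle.exp_arg]

theorem fourierChar_eq_one_iff {t : ℝ} : Real.fourierChar t = 1 ↔ ∃ n : ℤ, t = n := by
  refine ⟨fun h => ?_, ?_⟩
  · have h' := congrArg (Subtype.val : Circle → ℂ) h
    rw [Real.fourierChar_apply, Circle.coe_one, Complex.exp_eq_one_iff] at h'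
    obtain ⟨n, hn⟩ := h'
    refine ⟨n, ?_⟩
    have h2 : (2 * Real.pi * Complex.I : ℂ) ≠ 0 := by simp [Real.pi_ne_zero]
    have : (t : ℂ) = n := by
      apply mul_right_cancel₀ h2
      rw [← hn]
      push_cast
      ring
    exact_mod_cast this
  · rintro ⟨n, rfl⟩
    exact fourierChar_intCast n

/-- Both conditions are read off at the generator `1` of `ℤ`. -/
theorem isHomeomorph_torusBase : IsHomeomorph torusBase := by
  have : DiscreteTopology intLattice := inferInstance
  have : CompactSpace (ℝ ⧸ intLattice) := inferInstanceAs (CompactSpace UnitAddCircle)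
  refine isHomeomorph_baseMap intLattice realPairing realPairing_mem ?_ ?_
  · intro w hw
    have := hw 1 (AddSubgroup.mem_zmultiples 1)
    change Real.fourierChar (1 * w) = 1 at this
    obtain ⟨n, hn⟩ := fourierChar_eq_one_iff.1 this
    exact AddSubgroup.mem_zmultiples_iff.2 ⟨n, by simpa using hn.symm⟩
  · intro ω
    obtain ⟨w, hw⟩ := fourierChar_surjective (ω (Multiplicative.ofAdd 1))
    refine ⟨w, ?_⟩
    rintro _ ⟨n, rfl⟩
    change realPairing (Multiplicative.ofAdd w) (Multiplicative.ofAdd (n • (1 : ℝ))) =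
      ω (Multiplicative.ofAdd (n • (1 : ℝ)))
    rw [ofAdd_zsmul, map_zpow, map_zpow, ← hw]
    change Real.fourierChar (1 * w) ^ n = _
    rw [one_mul]

/-! ### Self-duality of the lattice in `ℝ × ℚ_p` -/

section Solenoid

variable {p : ℕ} [hp : Fact p.Prime]

theorem rqPairing_apply (v w : ℝ × ℚ_[p]) :
    rqPairing p (Multiplicative.ofAdd w) (Multiplicative.ofAdd v) =
      Real.fourierChar (v.1 * w.1) * Real.fourierChar (-(padicFrac (v.2 * w.2) : ℝ)) := rfl

theorem padicFrac_eq_zero_iff {x : ℚ_[p]} : padicFrac x = 0 ↔ ‖x‖ ≤ 1 := by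
  refine ⟨fun h => ?_, fun h => ?_⟩
  · simpa [h] using norm_sub_padicFrac_le x
  · exact padicFrac_unique (zInv p).zero_mem le_rfl one_pos (by simpa using h)

theorem intCast_mem_zInv (n : ℤ) : (n : ℚ) ∈ zInv p := ⟨n, 0, by simp⟩

theorem intCast_mem_diagLattice (n : ℤ) : ((n : ℝ), (n : ℚ_[p])) ∈ diagLattice p :=
  mem_diagLattice.2 ⟨n, intCast_mem_zInv n, by simp⟩

theorem inv_pow_mem_diagLattice (k : ℕ) :
    (((p : ℝ) ^ k)⁻¹, ((p : ℚ_[p]) ^ k)⁻¹) ∈ diagLattice p :=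
  mem_diagLattice.2 ⟨((p : ℚ) ^ k)⁻¹, ⟨1, k, by simp⟩, by simp⟩

theorem norm_add_intCast_le_one {x : ℚ_[p]} (hx : ‖x‖ ≤ 1) (n : ℤ) :
    ‖x + (n : ℚ_[p])‖ ≤ 1 :=
  (IsUltrametricDist.norm_add_le_max _ _).trans (max_le hx (Padic.norm_int_le_one n))

variable (p) in
/-- The compact set `[0, 1] × ℤ_p`. -/
def fundamentalCompact : Set (ℝ × ℚ_[p]) := Set.Icc 0 1 ×ˢ Metric.closedBall 0 1

theorem isCompact_fundamentalCompact : IsCompact (fundamentalCompact p) :=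
  isCompact_Icc.prod (isCompact_closedBall 0 1)

/-- Every element of `ℝ × ℚ_p` is congruent to an element of `[0, 1) × ℤ_p`. -/
theorem exists_sub_mem_diagLattice (v : ℝ × ℚ_[p]) :
    ∃ l ∈ diagLattice p, 0 ≤ (v - l).1 ∧ (v - l).1 < 1 ∧ ‖(v - l).2‖ ≤ 1 := by
  -- The fractional part moves the second coordinate into `ℤ_p`; the floor then normalizes the
  -- first, and subtracting an integer does not leave `ℤ_p`.
  refine ⟨_, (diagLattice p).add_mem
    (mem_diagLattice.2 ⟨padicFrac v.2, padicFrac_mem v.2, rfl⟩)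
    (intCast_mem_diagLattice ⌊v.1 - padicFrac v.2⌋), ?_, ?_, ?_⟩
  · have := Int.floor_le (v.1 - padicFrac v.2)
    simp only [Prod.fst_sub, Prod.fst_add]
    linarith
  · have := Int.lt_floor_add_one (v.1 - padicFrac v.2)
    simp only [Prod.fst_sub, Prod.fst_add]
    linarith
  · have := norm_add_intCast_le_one (norm_sub_padicFrac_le v.2) (-⌊v.1 - padicFrac v.2⌋)
    simpa [sub_eq_add_neg, add_assoc, add_comm, add_left_comm] using this

instance : CompactSpace (Solenoid p) := by
  refine ⟨(isCompact_fundamentalCompact.image QuotientAddGroup.continuous_mk).of_isClosed_subset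
    isClosed_univ ?_⟩
  rintro a -
  induction a using QuotientAddGroup.induction_on with
  | H v =>
    obtain ⟨l, hl, h0, h1, h2⟩ := exists_sub_mem_diagLattice v
    exact ⟨v - l, ⟨⟨h0, h1.le⟩, mem_closedBall_zero_iff.2 h2⟩,
      QuotientAddGroup.eq.2 (by simpa using hl)⟩

/-- The lattice pairs trivially with itself, so `w` may be moved into the fundamental domain without
changing its character on the lattice. -/
theorem rqPairing_sub_apply {l v : ℝ × ℚ_[p]} (hl : l ∈ diagLattice p) (hv : v ∈ diagLattice p)
    (w : ℝ × ℚ_[p]) :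
    rqPairing p (Multiplicative.ofAdd (w - l)) (Multiplicative.ofAdd v) =
      rqPairing p (Multiplicative.ofAdd w) (Multiplicative.ofAdd v) := by
  conv_rhs => rw [← sub_add_cancel w l, ofAdd_add, map_mul]
  exact ((congrArg (_ * ·) (rqPairing_mem l hl v hv)).trans (mul_one _)).symm

theorem mem_diagLattice_of_rqPairing_mem {w : ℝ × ℚ_[p]}
    (hw : rqPairing p (Multiplicative.ofAdd w) ∈ annihilator (diagLattice p)) :
    w ∈ diagLattice p := by
  obtain ⟨l, hl, h0, h1, h2⟩ := exists_sub_mem_diagLattice w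
  suffices h : w - l = 0 by rwa [sub_eq_zero.1 h]
  set u := w - l with hu
  have hu' : ∀ v ∈ diagLattice p,
      Real.fourierChar (v.1 * u.1) * Real.fourierChar (-(padicFrac (v.2 * u.2) : ℝ)) = 1 := by
    intro v hv
    rw [← rqPairing_apply, hu, rqPairing_sub_apply hl hv]
    exact hw v hv
  -- Test against `(1, 1)`: the `p`-adic factor is trivial since `u.2 ∈ ℤ_p`, so `u.1` is an integer
  -- in `[0, 1)`.
  have e1 : u.1 = 0 := by
    have := hu' _ (intCast_mem_diagLattice 1)
    simp only [Int.cast_one, one_mul, padicFrac_eq_zero_iff.2 h2, Rat.cast_zero, neg_zero,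
      AddChar.map_zero_eq_one, mul_one] at this
    obtain ⟨n, hn⟩ := fourierChar_eq_one_iff.1 this
    rw [hn] at h0 h1 ⊢
    have a0 : 0 ≤ n := by exact_mod_cast h0
    have a1 : n < 1 := by exact_mod_cast h1
    have : n = 0 := by omega
    simp [this]
  have hp1 : (1 : ℝ) < p := by exact_mod_cast hp.1.one_lt
  -- Test against `(p⁻ᵏ, p⁻ᵏ)`: the fractional part of `p⁻ᵏ u.2` is an integer in `[0, 1)`, hence
  -- zero, so `p⁻ᵏ u.2 ∈ ℤ_p`.
  have e2 : ∀ k : ℕ, (p : ℝ) ^ k * ‖u.2‖ ≤ 1 := by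
    intro k
    have := hu' _ (inv_pow_mem_diagLattice k)
    rw [e1, mul_zero, AddChar.map_zero_eq_one, one_mul] at this
    obtain ⟨n, hn⟩ := fourierChar_eq_one_iff.1 this
    set q := padicFrac (((p : ℚ_[p]) ^ k)⁻¹ * u.2) with hq
    have a0 := padicFrac_nonneg (((p : ℚ_[p]) ^ k)⁻¹ * u.2)
    have a1 := padicFrac_lt_one (((p : ℚ_[p]) ^ k)⁻¹ * u.2)
    rw [← hq] at a0 a1
    have hn' : q = ((-n : ℤ) : ℚ) := by
      have : (q : ℝ) = ((-n : ℤ) : ℝ) := by push_cast; linarith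
      exact_mod_cast this
    rw [hn'] at a0 a1
    have b0 : 0 ≤ -n := by exact_mod_cast a0
    have b1 : -n < 1 := by exact_mod_cast a1
    have hn0 : -n = 0 := by omega
    rw [hn0, Int.cast_zero] at hn'
    have := padicFrac_eq_zero_iff.1 hn'
    simpa [norm_mul, norm_inv, norm_pow, Padic.norm_p] using this
  have e3 : u.2 = 0 := by
    by_contra hne
    obtain ⟨k, hk⟩ := pow_unbounded_of_one_lt (‖u.2‖⁻¹) hp1
    have := e2 k
    rw [← le_div_iff₀ (norm_pos_iff.2 hne), one_div] at this
    linarith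
  exact Prod.ext e1 e3

/-- Every character of `ℝ × ℚ_p` agrees on `ℤ[1/p]^Δ` with one given by the pairing. -/
theorem exists_rqPairing_eq (ω : CharGroup (ℝ × ℚ_[p])) :
    ∃ w, ∀ l ∈ diagLattice p, rqPairing p (Multiplicative.ofAdd w) (Multiplicative.ofAdd l) =
      ω (Multiplicative.ofAdd l) := by
  have hp0 : (p : ℝ) ≠ 0 := by exact_mod_cast hp.1.ne_zero
  have hp0' : (p : ℚ_[p]) ≠ 0 := by exact_mod_cast hp.1.ne_zero
  -- The lattice is the increasing union of the cyclic groups generated by the `g k`, since `g k = p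
  -- • g (k + 1)`.
  let g : ℕ → ℝ × ℚ_[p] := fun k => (((p : ℝ) ^ k)⁻¹, ((p : ℚ_[p]) ^ k)⁻¹)
  have hg : ∀ k, Multiplicative.ofAdd (g k) = Multiplicative.ofAdd (g (k + 1)) ^ p := by
    intro k
    rw [← ofAdd_nsmul]
    congr 1
    ext
    · rw [Prod.smul_fst, nsmul_eq_mul]
      simp only [g, pow_succ]
      field_simp
    · rw [Prod.smul_snd, nsmul_eq_mul]
      simp only [g, pow_succ]
      field_simp
  -- Solutions of the problem on the group generated by `g k`. Agreement at `g (k + 1)` forces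
  -- agreement at `g k`, so these compact sets decrease, and a common point solves it on the whole
  -- lattice.
  let C : ℕ → Set (ℝ × ℚ_[p]) := fun k => fundamentalCompact p ∩
    {w | rqPairing p (Multiplicative.ofAdd w) (Multiplicative.ofAdd (g k)) =
      ω (Multiplicative.ofAdd (g k))}
  have hclosed : ∀ k, IsClosed (C k) := fun k =>
    isCompact_fundamentalCompact.isClosed.inter (isClosed_eq
      ((continuous_eval_const (F := Multiplicative (ℝ × ℚ_[p]) →ₜ* Circle)
        (Multiplicative.ofAdd (g k))).comp ((map_continuous (rqPairing p)).comp continuous_ofAdd))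
      continuous_const)
  obtain ⟨w, hw⟩ := IsCompact.nonempty_iInter_of_sequence_nonempty_isCompact_isClosed C
    (by
      rintro k w ⟨hK, hw⟩
      refine ⟨hK, ?_⟩
      simp only [Set.mem_ofPred_eq] at hw ⊢
      rw [hg k, map_pow, map_pow, hw])
    (by
      intro k
      obtain ⟨θ, hθ⟩ := fourierChar_surjective (ω (Multiplicative.ofAdd (g k)))
      -- The point `(pᵏ θ, 0)` pairs with `g k` to `e^{2πi θ}`; it is then moved into the compact
      -- set.
      obtain ⟨l, hl, h0, h1, h2⟩ := exists_sub_mem_diagLattice ((p : ℝ) ^ k * θ, (0 : ℚ_[p]))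
      refine ⟨_, ⟨⟨h0, h1.le⟩, mem_closedBall_zero_iff.2 h2⟩, ?_⟩
      rw [Set.mem_ofPred_eq, rqPairing_sub_apply hl (inv_pow_mem_diagLattice k), rqPairing_apply,
        ← hθ]
      simp [padicFrac_eq_zero_iff.2, hp0])
    (isCompact_fundamentalCompact.inter_right (isClosed_eq
      ((continuous_eval_const (F := Multiplicative (ℝ × ℚ_[p]) →ₜ* Circle)
        (Multiplicative.ofAdd (g 0))).comp ((map_continuous (rqPairing p)).comp continuous_ofAdd))
      continuous_const)) hclosed
  refine ⟨w, fun l hl => ?_⟩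
  obtain ⟨q, ⟨n, k, rfl⟩, rfl⟩ := mem_diagLattice.1 hl
  have hn : ((((n / (p : ℚ) ^ k : ℚ) : ℝ), ((n / (p : ℚ) ^ k : ℚ) : ℚ_[p])) : ℝ × ℚ_[p]) =
      n • g k := by
    ext <;> simp [g, div_eq_mul_inv]
  rw [hn, ofAdd_zsmul, map_zpow, map_zpow, ((Set.mem_iInter.1 hw k).2 : _ = _)]

theorem isHomeomorph_solenoidBase : IsHomeomorph (solenoidBase p) :=
  isHomeomorph_baseMap _ _ _ (fun _ => mem_diagLattice_of_rqPairing_mem) exists_rqPairing_eq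

end Solenoid

/-! ### Linear fibre coordinates and maps into pullbacks -/

section General

variable {G : Type*} [AddCommGroup G] [TopologicalSpace G] {Λ : AddSubgroup G}

/-- A set-theoretic section identifies each fibre with `ℂ` linearly. -/
def fiberLinearEquiv (s : G ⧸ Λ → G) (hs : ∀ a, (s a : G ⧸ Λ) = a) (b : BaseSpace Λ) :
    Fiber Λ b ≃ₗ[ℂ] ℂ :=
  { fiberEquiv s hs b with
    map_add' := (isLinearMap_coord s hs b).map_add
    map_smul' := (isLinearMap_coord s hs b).map_smul }

theorem continuous_pullback_coe {B : Type*} [TopologicalSpace B] (φ : B → BaseSpace Λ) :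
    Continuous (fun e : TotalSpace ℂ (φ *ᵖ (Fiber Λ)) => (e.2.1 : Total Λ)) :=
  (continuous_induced_dom : Continuous (fun e : TotalSpace ℂ (Fiber Λ) => e.2.1)).comp
    (Pullback.continuous_lift ℂ (Fiber Λ) φ)

end General

/-- A map into a pullback bundle is continuous if its components are. -/
theorem continuous_pullback_iff {B B' F X : Type*} {E : B → Type*} [TopologicalSpace B]
    [TopologicalSpace B'] [TopologicalSpace X] [TopologicalSpace (TotalSpace F E)] (φ : B' → B)
    (f : X → TotalSpace F (φ *ᵖ E)) :
    Continuous f ↔ Continuous (fun x => (f x).proj) ∧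
      Continuous (fun x => Pullback.lift φ (f x)) := by
  rw [(inducing_pullbackTotalSpaceEmbedding F E φ).continuous_iff]
  exact continuous_prodMk

/-! ### Lifting sections from the circle to the solenoid -/

section Solenoid

variable {p : ℕ} [hp : Fact p.Prime]

theorem solenoidProj_mk (v : ℝ × ℚ_[p]) :
    solenoidProj p (v : Solenoid p) = ((v.1 - padicFrac v.2 : ℝ) : UnitAddCircle) := rfl

theorem solenoidProj_mk_of_norm_le_one {v : ℝ × ℚ_[p]} (hv : ‖v.2‖ ≤ 1) :
    solenoidProj p (v : Solenoid p) = ((v.1 : ℝ) : UnitAddCircle) := by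
  rw [solenoidProj_mk, padicFrac_eq_zero_iff.2 hv, Rat.cast_zero, sub_zero]

theorem coe_unitAddCircle_eq_iff {s t : ℝ} :
    (s : UnitAddCircle) = t ↔ ∃ n : ℤ, s = t + n := by
  refine QuotientAddGroup.eq.trans (AddSubgroup.mem_zmultiples_iff.trans ⟨?_, ?_⟩)
  · rintro ⟨n, hn⟩
    refine ⟨-n, ?_⟩
    rw [zsmul_eq_mul, mul_one] at hn
    push_cast
    linarith
  · rintro ⟨n, rfl⟩
    exact ⟨-n, by simp⟩

/-- Every point of the solenoid has a representative whose first coordinate is the chosen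
representative of its image in `ℝ / ℤ`. -/
theorem exists_lift {s : ℝ ⧸ intLattice → ℝ} (hs : ∀ a, (s a : ℝ ⧸ intLattice) = a)
    (a : Solenoid p) : ∃ v : ℝ × ℚ_[p], (v : Solenoid p) = a ∧ v.1 = s (solenoidProj p a) := by
  induction a using QuotientAddGroup.induction_on with
  | H v =>
    obtain ⟨n, hn⟩ := coe_unitAddCircle_eq_iff.1
      ((hs (solenoidProj p (v : Solenoid p))).trans (solenoidProj_mk v))
    -- The shift is the element of `ℤ[1/p]` that turns `v.1` into the prescribed first coordinate.
    refine ⟨v + (((-padicFrac v.2 + n : ℚ) : ℝ), ((-padicFrac v.2 + n : ℚ) : ℚ_[p])), ?_, ?_⟩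
    · refine (QuotientAddGroup.eq.2 ?_).symm
      rw [neg_add_cancel_left]
      exact mem_diagLattice.2 ⟨_, (zInv p).add_mem ((zInv p).neg_mem (padicFrac_mem _))
        (intCast_mem_zInv n), rfl⟩
    · rw [hn, Prod.fst_add]
      push_cast
      ring

theorem exists_sub_eq (s : ℝ ⧸ intLattice → ℝ) (hs : ∀ a, (s a : ℝ ⧸ intLattice) = a)
    (v : ℝ × ℚ_[p]) :
    ∃ n : ℤ, v.1 - padicFrac v.2 - s (solenoidProj p (v : Solenoid p)) = n := by
  obtain ⟨n, hn⟩ := coe_unitAddCircle_eq_iff.1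
    ((solenoidProj_mk v).symm.trans (hs (solenoidProj p (v : Solenoid p))).symm)
  exact ⟨n, by rw [hn]; ring⟩

/-- The section of `ℝ × ℚ_p → 𝒮_p` with first coordinate `s ∘ π₀`, for a section `s` of
`ℝ → ℝ / ℤ`. -/
def liftSection (s : ℝ ⧸ intLattice → ℝ) (hs : ∀ a, (s a : ℝ ⧸ intLattice) = a) (a : Solenoid p) :
    ℝ × ℚ_[p] := (exists_lift hs a).choose

section

variable (s : ℝ ⧸ intLattice → ℝ) (hs : ∀ a, (s a : ℝ ⧸ intLattice) = a)

theorem coe_liftSection (a : Solenoid p) : (liftSection s hs a : Solenoid p) = a :=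
  (exists_lift hs a).choose_spec.1

theorem liftSection_fst (a : Solenoid p) : (liftSection s hs a).1 = s (solenoidProj p a) :=
  (exists_lift hs a).choose_spec.2

/-- The difference lies in the lattice, and a diagonal element is determined by its real coordinate
because `ℚ → ℝ` is injective. -/
theorem liftSection_mk {v : ℝ × ℚ_[p]} {q : ℚ}
    (hq : (q : ℝ) = v.1 - s (solenoidProj p (v : Solenoid p))) :
    v - liftSection s hs (v : Solenoid p) = ((q : ℝ), (q : ℚ_[p])) := by
  obtain ⟨r, -, hr⟩ := mem_diagLattice.1 (QuotientAddGroup.eq.1 (coe_liftSection s hs (v : Solenoid p)))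
  rw [neg_add_eq_sub] at hr
  rw [hr]
  have h1 := congrArg Prod.fst hr
  rw [Prod.fst_sub, liftSection_fst, ← hq, Rat.cast_inj] at h1
  rw [h1]

/-- Pulled back to `ℝ × ℚ_p`, the lift is `v ↦ (s (π₀ [v]), v.2 - {v.2}_p - n v)`, where `n v` is an
integer depending continuously on `v`. -/
theorem continuousOn_liftSection {U : Set (ℝ ⧸ intLattice)} (hU : IsOpen U)
    (hc : ContinuousOn s U) :
    ContinuousOn (liftSection s hs : Solenoid p → ℝ × ℚ_[p]) (solenoidProj p ⁻¹' U) := by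
  have hπ := map_continuous (solenoidProj p)
  have hs1 : ContinuousOn (fun v : ℝ × ℚ_[p] => s (solenoidProj p (v : Solenoid p)))
      {v | solenoidProj p (v : Solenoid p) ∈ U} :=
    hc.comp (f := fun v : ℝ × ℚ_[p] => solenoidProj p (v : Solenoid p))
      (hπ.comp QuotientAddGroup.continuous_mk).continuousOn (fun _ h => h)
  choose n hn using exists_sub_eq (p := p) s hs
  have hnc : ContinuousOn n {v | solenoidProj p (v : Solenoid p) ∈ U} := by
    -- Continuity into the discrete group `ℤ` is tested in `ℝ`, where `n` has an explicit formula.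
    rw [Int.isClosedEmbedding_coe_real.isInducing.continuousOn_iff]
    have : (fun m : ℤ => (m : ℝ)) ∘ n =
        fun v : ℝ × ℚ_[p] => v.1 - padicFrac v.2 - s (solenoidProj p (v : Solenoid p)) := by
      ext v
      exact (hn v).symm
    rw [this]
    exact (continuous_fst.sub (continuous_padicFrac.comp continuous_snd)).continuousOn.sub hs1
  have hfrac : Continuous (fun x : ℚ_[p] => (padicFrac x : ℚ_[p])) := by
    refine IsLocallyConstant.continuous ((IsLocallyConstant.iff_eventually_eq _).2 fun x => ?_)
    filter_upwards [Metric.ball_mem_nhds x one_pos] with y hy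
    rw [padicFrac_congr (x := y) (y := x) (by rw [← dist_eq_norm]; exact hy.le)]
  refine (IsQuotientMap.continuousOn_isOpen_iff
    (QuotientAddGroup.isQuotientMap_mk (N := diagLattice p)) (hU.preimage hπ)).2 ?_
  have e : (liftSection s hs : Solenoid p → ℝ × ℚ_[p]) ∘ QuotientAddGroup.mk = fun v : ℝ × ℚ_[p] =>
      (s (solenoidProj p (v : Solenoid p)), v.2 - (padicFrac v.2 + (n v : ℚ_[p]))) := by
    ext1 v
    refine Prod.ext (liftSection_fst s hs (v : Solenoid p)) ?_
    have h := liftSection_mk s hs (v := v) (q := padicFrac v.2 + n v)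
      (by push_cast; rw [← hn v]; ring)
    have h2 := congrArg Prod.snd h
    rw [Prod.snd_sub] at h2
    push_cast at h2
    rw [← h2]
    exact (sub_sub_cancel _ _).symm
  rw [e]
  refine hs1.prodMk (continuousOn_snd.sub ((hfrac.comp continuous_snd).continuousOn.add ?_))
  -- Discreteness of `ℤ` carries the continuity of `n` over from `ℝ` to `ℚ_p`.
  exact (continuous_of_discreteTopology (f := fun m : ℤ => (m : ℚ_[p]))).comp_continuousOn hnc

end

/-! ### Comparison of the fibres -/

theorem solenoid_exists_rep (a : Solenoid p) :
    ∃ v : ℝ × ℚ_[p], (v : Solenoid p) = a ∧ ‖v.2‖ ≤ 1 := by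
  induction a using QuotientAddGroup.induction_on with
  | H v =>
    obtain ⟨l, hl, -, -, h2⟩ := exists_sub_mem_diagLattice v
    exact ⟨v - l, QuotientAddGroup.eq.2 (by simpa using hl), h2⟩

/-- On `ℝ × ℤ_p`, the coordinate of `[v, χ w, z]` with respect to a lifted section is that of
`[v₁, χ w₁, z]` with respect to the original one. -/
theorem coord_liftSection_mk (s : ℝ ⧸ intLattice → ℝ) (hs : ∀ a, (s a : ℝ ⧸ intLattice) = a)
    {v w : ℝ × ℚ_[p]} (hv : ‖v.2‖ ≤ 1) (hw : ‖w.2‖ ≤ 1) (z : ℂ) :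
    coord (liftSection s hs) (coe_liftSection s hs)
        (Total.mk (diagLattice p) v (rqPairing p (Multiplicative.ofAdd w)) z) =
      coord s hs (Total.mk intLattice v.1 (realPairing (Multiplicative.ofAdd w.1)) z) := by
  -- As `{v.2}_p = 0`, the difference of `v` and its lifted representative is `(n, n)` with `n` an
  -- integer, and `n w.2` stays in `ℤ_p`: only the real factor of the pairing survives.
  obtain ⟨n, hn⟩ := exists_sub_eq s hs v
  rw [padicFrac_eq_zero_iff.2 hv, Rat.cast_zero, sub_zero] at hn
  rw [coord_mk, coord_mk, liftSection_mk s hs (q := n) (by rw [hn, Rat.cast_intCast])]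
  have h1 : padicFrac (((n : ℚ) : ℚ_[p]) * w.2) = 0 := by
    rw [padicFrac_eq_zero_iff, norm_mul, Rat.cast_intCast]
    exact mul_le_one₀ (Padic.norm_int_le_one n) (norm_nonneg _) hw
  have h2 : rqPairing p (Multiplicative.ofAdd w)
      (Multiplicative.ofAdd (((n : ℚ) : ℝ), ((n : ℚ) : ℚ_[p]))) =
      realPairing (Multiplicative.ofAdd w.1)
        (Multiplicative.ofAdd (v.1 - s (v.1 : ℝ ⧸ intLattice))) := by
    rw [rqPairing_apply]
    change _ = Real.fourierChar ((v.1 - s (v.1 : ℝ ⧸ intLattice)) * w.1)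
    rw [← solenoidProj_mk_of_norm_le_one hv, hn]
    rw [h1]
    simp
  rw [charVal, charVal, h2]

/-- An element of the fibre over `b` has a counterpart in the fibre of the torus bundle whose
coordinates with respect to all sections are the same. -/
theorem exists_coord_liftSection_eq (b : Solenoid p × Solenoid p) (e : Total (diagLattice p))
    (he : e.proj = solenoidBase p b) :
    ∃ e' : Total intLattice, e'.proj = torusBase (solenoidProjSq p b) ∧
      ∀ s hs, coord (liftSection s hs) (coe_liftSection s hs) e = coord s hs e' := by
  obtain ⟨a, c⟩ := b
  obtain ⟨v, rfl, hv⟩ := solenoid_exists_rep a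
  obtain ⟨w, rfl, hw⟩ := solenoid_exists_rep c
  obtain ⟨z, hz⟩ := fiberMk_surjective v (rqPairing p (Multiplicative.ofAdd w)) ⟨e, he⟩
  obtain rfl : e = _ := congrArg Subtype.val hz
  -- This element is built from representatives over `ℤ_p` only, so one choice serves all sections
  -- `s`.
  refine ⟨Total.mk intLattice v.1 (realPairing (Multiplicative.ofAdd w.1)) z, ?_,
    fun s hs => coord_liftSection_mk s hs hv hw z⟩
  change _ = torusBase (solenoidProj p (v : Solenoid p), solenoidProj p (w : Solenoid p))
  rw [solenoidProj_mk_of_norm_le_one hv, solenoidProj_mk_of_norm_le_one hw]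
  rfl

/-- The isomorphism of the fibres given by a section `s` of `ℝ → ℝ / ℤ`. -/
def solenoidFiberEquiv (s : ℝ ⧸ intLattice → ℝ) (hs : ∀ a, (s a : ℝ ⧸ intLattice) = a)
    (b : Solenoid p × Solenoid p) :
    Fiber (diagLattice p) (solenoidBase p b) ≃ₗ[ℂ]
      Fiber intLattice (torusBase (solenoidProjSq p b)) :=
  (fiberLinearEquiv (liftSection s hs) (coe_liftSection s hs) _).trans
    (fiberLinearEquiv s hs _).symm

/-- Both maps send `e` to the counterpart that has equal coordinates for every section. Thus the
global isomorphism, defined by an arbitrary section, can be computed near each point by a section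
continuous there. -/
theorem solenoidFiberEquiv_eq (s s' : ℝ ⧸ intLattice → ℝ)
    (hs : ∀ a, (s a : ℝ ⧸ intLattice) = a) (hs' : ∀ a, (s' a : ℝ ⧸ intLattice) = a)
    (b : Solenoid p × Solenoid p) : solenoidFiberEquiv s hs b = solenoidFiberEquiv s' hs' b := by
  ext e
  obtain ⟨e', he', h⟩ := exists_coord_liftSection_eq b e.1 e.2
  have key : ∀ r hr, solenoidFiberEquiv r hr b e = ⟨e', he'⟩ := by
    intro r hr
    refine Subtype.ext ?_
    change build r _ (coord (liftSection r hr) (coe_liftSection r hr) e.1) = e'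
    rw [h r hr, ← he', build_coord]
  rw [key s hs, key s' hs']

/-! ### The isomorphism of bundles -/

variable (p) in
/-- The isomorphism of the bundle over the squared solenoid with the pullback of the bundle over
the torus. -/
def solenoidBundleIso : VectorBundleIso ℂ ℂ ℂ (solenoidBundle p)
    (solenoidProjSq p *ᵖ torusBundle) where
  fiberEquiv b := solenoidFiberEquiv Quotient.out QuotientAddGroup.out_eq' b
  continuous_toFun := by
    have hproj : Continuous (TotalSpace.proj : TotalSpace ℂ (solenoidBundle p) → _) :=
      FiberBundle.continuous_proj ℂ (solenoidBundle p)
    have hsq := map_continuous (solenoidProjSq p)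
    refine (continuous_pullback_iff _ _).2 ⟨hproj, (continuous_pullback_iff _ _).2
      ⟨hsq.comp hproj, continuous_induced_rng.2 (continuous_iff_continuousAt.2 fun e₀ => ?_)⟩⟩
    obtain ⟨s, hs, U, hU, hc, hmem⟩ :=
      exists_section (Λ := intLattice) (solenoidProj p e₀.proj.1)
    have hV : IsOpen {e : TotalSpace ℂ (solenoidBundle p) | solenoidProj p e.proj.1 ∈ U} :=
      hU.preimage ((map_continuous (solenoidProj p)).comp (continuous_fst.comp hproj))
    refine ContinuousOn.continuousAt ?_ (hV.mem_nhds hmem)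
    -- In the coordinates of the locally continuous section `s` and its lift, the map is a `coord`
    -- followed by a `build`, each continuous over `U`.
    have h : ContinuousOn (fun e : TotalSpace ℂ (solenoidBundle p) =>
        build s (torusBase (solenoidProjSq p e.proj))
          (coord (liftSection s hs) (coe_liftSection s hs) e.2.1))
        {e | solenoidProj p e.proj.1 ∈ U} := by
      refine (continuousOn_build s hU hc).comp (f := fun e : TotalSpace ℂ (solenoidBundle p) =>
        (torusBase (solenoidProjSq p e.proj),
          coord (liftSection s hs) (coe_liftSection s hs) e.2.1))
        (ContinuousOn.prodMk ((map_continuous torusBase).comp (hsq.comp hproj)).continuousOn ?_)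
        (fun _ h => h)
      refine (continuousOn_coord _ (coe_liftSection s hs)
        (hU.preimage (map_continuous (solenoidProj p))) (continuousOn_liftSection s hs hU hc)).comp
        (continuous_pullback_coe (solenoidBase p)).continuousOn ?_
      intro e he
      change solenoidProj p (Total.proj e.2.1).1 ∈ U
      rw [e.2.2]
      exact he
    -- Independence of the section replaces `Quotient.out` by `s`.
    refine h.congr fun e _ => ?_
    exact congrArg Subtype.val (LinearEquiv.congr_fun
      (solenoidFiberEquiv_eq _ s QuotientAddGroup.out_eq' hs e.proj) e.2)
  continuous_invFun := by
    have hproj : Continuous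
        (TotalSpace.proj : TotalSpace ℂ (solenoidProjSq p *ᵖ torusBundle) → _) :=
      FiberBundle.continuous_proj ℂ (solenoidProjSq p *ᵖ torusBundle)
    refine (continuous_pullback_iff _ _).2
      ⟨hproj, continuous_induced_rng.2 (continuous_iff_continuousAt.2 fun e₀ => ?_)⟩
    obtain ⟨s, hs, U, hU, hc, hmem⟩ :=
      exists_section (Λ := intLattice) (solenoidProj p e₀.proj.1)
    have hV : IsOpen {e : TotalSpace ℂ (solenoidProjSq p *ᵖ torusBundle) |
        solenoidProj p e.proj.1 ∈ U} :=
      hU.preimage ((map_continuous (solenoidProj p)).comp (continuous_fst.comp hproj))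
    refine ContinuousOn.continuousAt ?_ (hV.mem_nhds hmem)
    -- The inverse reads the coordinate with `s` and rebuilds with the lift.
    have h : ContinuousOn (fun e : TotalSpace ℂ (solenoidProjSq p *ᵖ torusBundle) =>
        build (liftSection s hs) (solenoidBase p e.proj) (coord s hs e.2.1))
        {e | solenoidProj p e.proj.1 ∈ U} := by
      refine (continuousOn_build (liftSection s hs) (hU.preimage (map_continuous (solenoidProj p)))
        (continuousOn_liftSection s hs hU hc)).comp
        (f := fun e : TotalSpace ℂ (solenoidProjSq p *ᵖ torusBundle) =>
          (solenoidBase p e.proj, coord s hs e.2.1))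
        (ContinuousOn.prodMk ((map_continuous (solenoidBase p)).comp hproj).continuousOn ?_)
        (fun _ h => h)
      refine (continuousOn_coord s hs hU hc).comp
        ((continuous_pullback_coe torusBase).comp
          (Pullback.continuous_lift ℂ torusBundle (solenoidProjSq p))).continuousOn ?_
      intro e he
      change (Total.proj e.2.1).1 ∈ U
      rw [e.2.2]
      exact he
    refine h.congr fun e _ => ?_
    exact congrArg Subtype.val (LinearEquiv.congr_fun (congrArg LinearEquiv.symm
      (solenoidFiberEquiv_eq _ s QuotientAddGroup.out_eq' hs e.proj)) e.2)

end Solenoid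

end GaborBundle

end

theorem mainTheorem4 (p : ℕ) [Fact p.Prime] :
    IsHomeomorph GaborBundle.torusBase ∧ IsHomeomorph (GaborBundle.solenoidBase p) ∧
      Nonempty (GaborBundle.VectorBundleIso ℂ ℂ ℂ (GaborBundle.solenoidBundle p)
        (GaborBundle.solenoidProjSq p *ᵖ GaborBundle.torusBundle)) :=
  ⟨GaborBundle.isHomeomorph_torusBase, GaborBundle.isHomeomorph_solenoidBase,
    ⟨GaborBundle.solenoidBundleIso p⟩⟩
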